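/- Let $K$ be a field. A \emph{graded filtered Floer--Novikov complex} $\mathfrak{c}=(\pi\colon P\to S,\mathcal{A},\omega,gr,deg,\partial)$ over $K$ consists of the following data. $\Gamma$ is a finitely generated abelian group (written multiplicatively), $S$ is a finite set, and $\pi\colon P\to S$ is a principal $\Gamma$-bundle. There are functions $\mathcal{A}\colon P\to\mathbb{R}$, $gr\colon P\to\mathbb{Z}$ and homomorphisms $\omega\colon\Gamma\to\mathbb{R}$, $deg\colon\Gamma\to\mathbb{Z}$ with $\mathcal{A}(g\cdot p)=\mathcal{A}(p)-\omega(g)$ and $gr(g\cdot p)=gr(p)-deg(g)$ for $g\in\Gamma$, $p\in P$. Let $C_k=C_k(\mathfrak{c})$ be the $K$-vector space of formal sums $\sum_{p\in P,\,gr(p)=k}c_p\,p$ with $c_p\in K$ such that for every $C\in\mathbb{R}$ only finitely many $p$ have $c_p\ne0$ and $\mathcal{A}(p)>C$, and let $C_*=\bigoplus_{k\in\mathbb{Z}}C_k$. Let $\bar\Lambda$ be the Novikov ring of formal sums $\sum_{g\in\Gamma}b_g\,g$ with $b_g\in K$ such that $\{deg(g)\mid b_g\neq0\}$ is finite and for every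 $C\in\mathbb{R}$ only finitely many $g$ have $b_g\ne0$ and $\omega(g)<C$; it acts on $C_*$ through the $\Gamma$-action on $P$. Put $\ell(\sum c_p\,p)=\max\{\mathcal{A}(p)\mid c_p\ne0\}$ and $\ell(0)=-\infty$. Finally, $\partial\colon C_*\to C_*$ is a $\bar\Lambda$-module endomorphism with $\partial^2=0$, $\partial(C_k)\subset C_{k-1}$ for all $k$, and $\ell(\partial c)<\ell(c)$ for all $c\ne0$. For $a\in H_k(C_*)$ the \emph{spectral number} is $\rho_{\mathfrak{c}}(a)=\inf\{\ell(c)\mid c\in C_k,\ \partial c=0,\ [c]=a\}$. Write $\partial p=\sum_{q\in P}n(p,q)\,q$ for $p\in P$. The \emph{opposite complex} is $\mathfrak{c}^{op}=(\pi\colon P\to S,-\mathcal{A},\omega,-gr,deg,\delta)$, where $g\in\Gamma$ now acts on $P$ by $p\mapsto g^{-1}\cdot p$ and $\delta$ is determined by $\delta p=\sum_{q\in P}n(q,p)\,q$; it is again a graded filtered Floer--Novikov complex. Let $D_*=C_*(\mathfrak{c}^{op})$ be its chain complex. The pairing $\Delta\left(\sum d_p\,p,\sum c_p\,p\right)=\sum_{p\in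 P}d_pc_p$ on $D_*\times C_*$ satisfies $\Delta(\delta d,c)=\Delta(d,\partial c)$ and hence induces a $K$-bilinear pairing $\underline{\Delta}\colon H_{-k}(D_*)\times H_k(C_*)\to K$ for every $k\in\mathbb{Z}$. Suppose that $\omega$ is injective on $\ker(deg)$, let $k\in\mathbb{Z}$, and let $a\in H_k(C_*)$ be nonzero. Then $\rho_{\mathfrak{c}}(a)$ is a (finite) real number and \[ \rho_{\mathfrak{c}}(a)=-\inf\{\rho_{\mathfrak{c}^{op}}(b)\mid b\in H_{-k}(D_*),\ \underline{\Delta}(b,a)\neq 0\}. \] In particular, no discreteness of $\omega(\Gamma)\subset\mathbb{R}$ (rationality) is required. -/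

import Mathlib

/-- The data `(π : P → S, 𝒜, ω, gr, deg)` underlying a graded filtered Floer–Novikov complex.
The finitely generated abelian group `Γ` is written additively, and its action on `P` is a field
`act` (not a type class), because the opposite complex has another action on the same set. -/
structure FloerNovikovData (Γ P S : Type*) [AddCommGroup Γ] where
  fg : AddGroup.FG Γ
  finite_base : Finite S
  /-- The action of `Γ` on `P`. -/
  act : Γ → P → P
  zero_act : ∀ p, act 0 p = p
  add_act : ∀ g h p, act (g + h) p = act g (act h p)
  /-- The principal `Γ`-bundle `π : P → S`: a surjection whose fibres are the orbits of a free
  action. -/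
  proj : P → S
  proj_surjective : Function.Surjective proj
  proj_eq_iff : ∀ p q, proj p = proj q ↔ ∃ g, act g p = q
  act_free : ∀ g p, act g p = p → g = 0
  /-- The action functional `𝒜`. -/
  A : P → ℝ
  /-- The period homomorphism. -/
  ω : Γ →+ ℝ
  A_act : ∀ g p, A (act g p) = A p - ω g
  /-- The grading. -/
  gr : P → ℤ
  /-- The degree homomorphism. -/
  deg : Γ →+ ℤ
  gr_act : ∀ g p, gr (act g p) = gr p - deg g

/-- Arbitrary formal sums `∑ c_p p` with coefficients in `K`, encoded as the functions `p ↦ c_p`. -/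
def FormalSum (K P : Type*) := P → K

instance {K P : Type*} [Field K] : AddCommGroup (FormalSum K P) :=
  inferInstanceAs (AddCommGroup (P → K))

instance {K P : Type*} [Field K] : Module K (FormalSum K P) :=
  inferInstanceAs (Module K (P → K))

theorem FormalSum.sum_apply {K P ι : Type*} [Field K] (s : Finset ι) (f : ι → FormalSum K P)
    (p : P) : (∑ i ∈ s, f i) p = ∑ i ∈ s, f i p :=
  Finset.sum_apply (M := fun _ : P => K) p s f

namespace FloerNovikovData

variable {Γ P S : Type*} [AddCommGroup Γ] (X : FloerNovikovData Γ P S)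

theorem neg_act_act (g : Γ) (p : P) : X.act (-g) (X.act g p) = p := by
  rw [← X.add_act, neg_add_cancel, X.zero_act]

theorem act_neg_act (g : Γ) (p : P) : X.act g (X.act (-g) p) = p := by
  rw [← X.add_act, add_neg_cancel, X.zero_act]

theorem act_bijective (g : Γ) : Function.Bijective (X.act g) :=
  ⟨fun p q h => by rw [← X.neg_act_act g p, h, X.neg_act_act], fun p => ⟨_, X.act_neg_act g p⟩⟩

theorem act_left_injective (p : P) : Function.Injective fun g => X.act g p := by
  intro g h e
  have e' : X.act g p = X.act h p := e
  have : X.act (-h + g) p = p := by rw [X.add_act, e', X.neg_act_act]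
  have := X.act_free _ _ this
  rw [neg_add_eq_zero] at this
  exact this.symm

/-- The underlying data of the opposite complex. -/
def op : FloerNovikovData Γ P S where
  fg := X.fg
  finite_base := X.finite_base
  act g p := X.act (-g) p
  zero_act p := by rw [neg_zero, X.zero_act]
  add_act g h p := by rw [neg_add, X.add_act]
  proj := X.proj
  proj_surjective := X.proj_surjective
  proj_eq_iff p q := by
    rw [X.proj_eq_iff]
    exact ⟨fun ⟨g, h⟩ => ⟨-g, by rwa [neg_neg]⟩, fun ⟨g, h⟩ => ⟨-g, h⟩⟩
  act_free g p h := neg_eq_zero.mp (X.act_free _ _ h)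
  A p := -X.A p
  ω := X.ω
  A_act g p := by rw [X.A_act, map_neg]; ring
  gr p := -X.gr p
  deg := X.deg
  gr_act g p := by rw [X.gr_act, map_neg]; ring

variable (K : Type*) [Field K]

/-- The total Floer chain group `C_* = ⨁_k C_k`: the formal sums `∑ c_p p` that involve only finitely many gradings and, for every `C`, only finitely many
`p` with `𝒜(p) > C`. -/
def chains : Submodule K (FormalSum K P) where
  carrier := {c : P → K | (∀ C : ℝ, {p | c p ≠ 0 ∧ C < X.A p}.Finite) ∧
    (X.gr '' {p | c p ≠ 0}).Finite}
  zero_mem' := ⟨fun _ => Set.finite_empty.subset fun _ h => h.1 rfl,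
    Set.finite_empty.subset (by rintro _ ⟨_, h, rfl⟩; exact h rfl)⟩
  add_mem' := by
    intro a b ha hb
    have key : ∀ p, (a + b) p ≠ 0 → a p ≠ 0 ∨ b p ≠ 0 := by
      intro p h
      by_contra! h'
      exact h (by change a p + b p = 0; rw [h'.1, h'.2, add_zero])
    refine ⟨fun C => ((ha.1 C).union (hb.1 C)).subset ?_, (ha.2.union hb.2).subset ?_⟩
    · rintro p ⟨h, hC⟩
      exact (key p h).imp (⟨·, hC⟩) (⟨·, hC⟩)
    · rintro _ ⟨p, h, rfl⟩
      exact (key p h).imp (⟨p, ·, rfl⟩) (⟨p, ·, rfl⟩)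
  smul_mem' := by
    intro t a ha
    have key : ∀ p, (t • a) p ≠ 0 → a p ≠ 0 := fun p h => right_ne_zero_of_mul h
    exact ⟨fun C => (ha.1 C).subset fun p h => ⟨key p h.1, h.2⟩,
      ha.2.subset (Set.image_mono fun p h => key p h)⟩

/-- The degree-`k` part `C_k` of the Floer chain group. -/
def graded (k : ℤ) : Submodule K (X.chains K) where
  carrier := {c | ∀ p, c.1 p ≠ 0 → X.gr p = k}
  zero_mem' := fun _ h => absurd rfl h
  add_mem' := by
    intro a b ha hb p h
    by_cases h' : a.1 p = 0
    · refine hb p fun h'' => h ?_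
      change a.1 p + b.1 p = 0
      rw [h', h'', add_zero]
    · exact ha p h'
  smul_mem' := fun t a ha p h => ha p (right_ne_zero_of_mul (a := t) h)

/-- The Novikov ring `Λ̄ = ⨁_n e^n Λ`: the formal sums `∑ b_g g` that involve only finitely many degrees and, for every `C`, only finitely many `g` with `ω(g) < C`. -/
def novikov : Submodule K (FormalSum K Γ) where
  carrier := {b : Γ → K | (∀ C : ℝ, {g | b g ≠ 0 ∧ X.ω g < C}.Finite) ∧
    (X.deg '' {g | b g ≠ 0}).Finite}
  zero_mem' := ⟨fun _ => Set.finite_empty.subset fun _ h => h.1 rfl,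
    Set.finite_empty.subset (by rintro _ ⟨_, h, rfl⟩; exact h rfl)⟩
  add_mem' := by
    intro a b ha hb
    have key : ∀ p, (a + b) p ≠ 0 → a p ≠ 0 ∨ b p ≠ 0 := by
      intro p h
      by_contra! h'
      exact h (by change a p + b p = 0; rw [h'.1, h'.2, add_zero])
    refine ⟨fun C => ((ha.1 C).union (hb.1 C)).subset ?_, (ha.2.union hb.2).subset ?_⟩
    · rintro p ⟨h, hC⟩
      exact (key p h).imp (⟨·, hC⟩) (⟨·, hC⟩)
    · rintro _ ⟨p, h, rfl⟩
      exact (key p h).imp (⟨p, ·, rfl⟩) (⟨p, ·, rfl⟩)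
  smul_mem' := by
    intro t a ha
    have key : ∀ p, (t • a) p ≠ 0 → a p ≠ 0 := fun p h => right_ne_zero_of_mul h
    exact ⟨fun C => (ha.1 C).subset fun p h => ⟨key p h.1, h.2⟩,
      ha.2.subset (Set.image_mono fun p h => key p h)⟩

variable {K}

theorem chains_bddAbove (c : X.chains K) : ∃ M : ℝ, ∀ p, c.1 p ≠ 0 → X.A p ≤ M := by
  obtain ⟨M, hM⟩ := ((c.2.1 0).image X.A).bddAbove
  refine ⟨max M 0, fun p hp => ?_⟩
  by_cases h : 0 < X.A p
  · exact le_max_of_le_left (hM ⟨p, ⟨hp, h⟩, rfl⟩)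
  · exact le_max_of_le_right (not_lt.mp h)

theorem novikov_bddBelow (b : X.novikov K) : ∃ m : ℝ, ∀ g, b.1 g ≠ 0 → m ≤ X.ω g := by
  obtain ⟨m, hm⟩ := ((b.2.1 0).image X.ω).bddBelow
  refine ⟨min m 0, fun g hg => ?_⟩
  by_cases h : X.ω g < 0
  · exact min_le_of_left_le (hm ⟨g, ⟨hg, h⟩, rfl⟩)
  · exact min_le_of_right_le (not_lt.mp h)

theorem exists_ne_zero_of_finsum {ι : Type*} {f : ι → K} (h : ∑ᶠ i, f i ≠ 0) :
    ∃ i, f i ≠ 0 := by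
  by_contra! h'
  exact h (by simp [h'])

/-- The action of `Λ̄` on `C_*` induced by the action of `Γ` on `P`:
`(∑ b_g g) (∑ c_q q) = ∑ b_g c_q (g · q)`. The sum is finite for each `p`. -/
noncomputable def novikovSMul (b : X.novikov K) (c : X.chains K) : X.chains K :=
  ⟨fun p => ∑ᶠ g, b.1 g * c.1 (X.act (-g) p), by
    have key : ∀ p, ∑ᶠ g, b.1 g * c.1 (X.act (-g) p) ≠ 0 →
        ∃ g q, b.1 g ≠ 0 ∧ c.1 q ≠ 0 ∧ p = X.act g q := by
      intro p h
      obtain ⟨g, hg⟩ := exists_ne_zero_of_finsum h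
      exact ⟨g, _, left_ne_zero_of_mul hg, right_ne_zero_of_mul hg, (X.act_neg_act g p).symm⟩
    obtain ⟨M, hM⟩ := X.chains_bddAbove c
    obtain ⟨m, hm⟩ := X.novikov_bddBelow b
    refine ⟨fun C => ?_, ?_⟩
    · refine (((b.2.1 (M - C)).prod (c.2.1 (C + m))).image fun x => X.act x.1 x.2).subset ?_
      rintro p ⟨h, hC⟩
      obtain ⟨g, q, hg, hq, rfl⟩ := key p h
      rw [X.A_act] at hC
      have := hM q hq
      have := hm g hg
      exact ⟨(g, q), ⟨⟨hg, by linarith⟩, ⟨hq, by linarith⟩⟩, rfl⟩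
    · refine ((b.2.2.prod c.2.2).image fun x => x.2 - x.1).subset ?_
      rintro _ ⟨p, h, rfl⟩
      obtain ⟨g, q, hg, hq, rfl⟩ := key p h
      exact ⟨(X.deg g, X.gr q), ⟨⟨g, hg, rfl⟩, ⟨q, hq, rfl⟩⟩, (X.gr_act g q).symm⟩⟩

/-- The filtration level `ℓ(∑ c_p p) = max {𝒜(p) | c_p ≠ 0}`, with `ℓ(0) = -∞`. The supremum
of a nonzero chain is attained, see `exists_level_eq`. -/
noncomputable def level (c : X.chains K) : EReal := ⨆ p : {p : P // c.1 p ≠ 0}, (X.A p.1 : EReal)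

theorem le_level (c : X.chains K) {p : P} (hp : c.1 p ≠ 0) : (X.A p : EReal) ≤ X.level c :=
  le_iSup (fun p : {p : P // c.1 p ≠ 0} => (X.A p.1 : EReal)) ⟨p, hp⟩

theorem exists_level_eq (c : X.chains K) (hc : c ≠ 0) :
    ∃ p, c.1 p ≠ 0 ∧ X.level c = X.A p := by
  obtain ⟨p₀, hp₀⟩ : ∃ p, c.1 p ≠ 0 := by
    by_contra! h
    exact hc (Subtype.ext (funext h))
  obtain ⟨p, hp, hmax⟩ := Set.exists_max_image {p | c.1 p ≠ 0 ∧ X.A p₀ - 1 < X.A p} X.A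
    (c.2.1 _) ⟨p₀, hp₀, by linarith⟩
  refine ⟨p, hp.1, le_antisymm (iSup_le ?_) (X.le_level c hp.1)⟩
  rintro ⟨q, hq⟩
  rw [EReal.coe_le_coe_iff]
  by_cases h : X.A p₀ - 1 < X.A q
  · exact hmax q ⟨hq, h⟩
  · have := hp.2
    exact (not_lt.mp h).trans this.le

open Classical in
/-- The generator `p ∈ P` as a chain. -/
noncomputable def gen (K : Type*) [Field K] (p : P) : X.chains K :=
  ⟨Pi.single p 1, by
    have key : ∀ q, (Pi.single p 1 : P → K) q ≠ 0 → q = p := by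
      intro q h
      by_contra h'
      exact h (Pi.single_eq_of_ne h' _)
    exact ⟨fun C => (Set.finite_singleton p).subset fun q h => key q h.1,
      (Set.finite_singleton (X.gr p)).subset (by
        rintro _ ⟨q, h, rfl⟩
        rw [key q h]; rfl)⟩⟩

open Classical in
/-- The group element `g ∈ Γ` as an element of the Novikov ring. -/
noncomputable def novikovGen (K : Type*) [Field K] (g : Γ) : X.novikov K :=
  ⟨Pi.single g 1, by
    have key : ∀ q, (Pi.single g 1 : Γ → K) q ≠ 0 → q = g := by
      intro q h
      by_contra h'
      exact h (Pi.single_eq_of_ne h' _)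
    exact ⟨fun C => (Set.finite_singleton g).subset fun q h => key q h.1,
      (Set.finite_singleton (X.deg g)).subset (by
        rintro _ ⟨q, h, rfl⟩
        rw [key q h]; rfl)⟩⟩

theorem gen_self (p : P) : (X.gen K p).1 p = 1 := by
  classical
  simp [gen]

theorem eq_of_gen_ne_zero {p q : P} (h : (X.gen K p).1 q ≠ 0) : q = p := by
  classical
  by_contra h'
  exact h (by simp [gen, h'])

theorem novikovGen_smul (g : Γ) (c : X.chains K) (p : P) :
    (X.novikovSMul (X.novikovGen K g) c).1 p = c.1 (X.act (-g) p) := by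
  classical
  change ∑ᶠ h, (Pi.single g 1 : Γ → K) h * c.1 (X.act (-h) p) = _
  rw [finsum_eq_single _ g]
  · simp
  · intro h hh
    simp [hh]

theorem novikovGen_smul_gen (g : Γ) (p : P) :
    X.novikovSMul (X.novikovGen K g) (X.gen K p) = X.gen K (X.act g p) := by
  classical
  refine Subtype.ext (funext fun q => ?_)
  rw [novikovGen_smul]
  by_cases h : q = X.act g p
  · rw [h, X.neg_act_act, gen_self, gen_self]
  · have h' : X.act (-g) q ≠ p := fun e => h (by rw [← e, X.act_neg_act])
    rw [not_imp_comm.mp X.eq_of_gen_ne_zero h', not_imp_comm.mp X.eq_of_gen_ne_zero h]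

theorem gen_ne_zero (p : P) : X.gen K p ≠ 0 := by
  intro h
  have := X.gen_self (K := K) p
  rw [h] at this
  exact zero_ne_one this

theorem finsum_swap {ι κ : Type*} (f : ι → κ → K)
    (h : {x : ι × κ | f x.1 x.2 ≠ 0}.Finite) :
    ∑ᶠ i, ∑ᶠ j, f i j = ∑ᶠ j, ∑ᶠ i, f i j := by
  have h' : {x : κ × ι | f x.2 x.1 ≠ 0}.Finite :=
    (h.image Prod.swap).subset fun x hx => ⟨x.swap, hx, rfl⟩
  rw [← finsum_curry (fun x : ι × κ => f x.1 x.2) h,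
    ← finsum_curry (fun x : κ × ι => f x.2 x.1) h']
  exact finsum_eq_of_bijective Prod.swap Prod.swap_bijective fun _ => rfl

end FloerNovikovData

/-- A graded filtered Floer–Novikov complex over the field `K`. -/
structure FloerNovikovComplex (K Γ P S : Type*) [Field K] [AddCommGroup Γ] extends
    FloerNovikovData Γ P S where
  /-- The Floer boundary operator `∂`, an endomorphism of the `Λ̄`-module `C_*`. -/
  d : toFloerNovikovData.chains K →ₗ[K] toFloerNovikovData.chains K
  d_novikovSMul : ∀ (b : toFloerNovikovData.novikov K) (c : toFloerNovikovData.chains K),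
    d (toFloerNovikovData.novikovSMul b c) = toFloerNovikovData.novikovSMul b (d c)
  d_d : ∀ c, d (d c) = 0
  level_d_lt : ∀ c, c ≠ 0 → toFloerNovikovData.level (d c) < toFloerNovikovData.level c
  d_mem_graded : ∀ k, ∀ c ∈ toFloerNovikovData.graded K k, d c ∈ toFloerNovikovData.graded K (k - 1)

namespace FloerNovikovComplex

open FloerNovikovData

variable {K Γ P S : Type*} [Field K] [AddCommGroup Γ] (X : FloerNovikovComplex K Γ P S)

/-- The matrix coefficients of the boundary operator: `∂ p = ∑ n(p, q) q`. -/
noncomputable def n (p q : P) : K := (X.d (X.gen K p)).1 q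

theorem n_act (g : Γ) (p q : P) : X.n (X.act g p) (X.act g q) = X.n p q := by
  unfold n
  rw [← X.novikovGen_smul_gen, X.d_novikovSMul, X.novikovGen_smul, X.neg_act_act]

theorem n_act_left (g : Γ) (p q : P) : X.n (X.act g p) q = X.n p (X.act (-g) q) := by
  rw [← X.n_act g p, X.act_neg_act]

theorem A_lt_of_n {p q : P} (h : X.n p q ≠ 0) : X.A q < X.A p := by
  have h1 := X.le_level _ h
  have h2 := X.level_d_lt _ (X.gen_ne_zero (K := K) p)
  obtain ⟨r, hr, e⟩ := X.exists_level_eq _ (X.gen_ne_zero (K := K) p)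
  rw [X.eq_of_gen_ne_zero hr] at e
  rw [e] at h2
  exact EReal.coe_lt_coe_iff.mp (h1.trans_lt h2)

theorem gr_of_n {p q : P} (h : X.n p q ≠ 0) : X.gr q = X.gr p - 1 :=
  X.d_mem_graded (X.gr p) (X.gen K p) (fun r hr => by rw [X.eq_of_gen_ne_zero hr]) q h

theorem finite_n_right (p : P) (C : ℝ) : {q | X.n p q ≠ 0 ∧ C < X.A q}.Finite :=
  (X.d (X.gen K p)).2.1 C

/-- A section of the bundle. -/
noncomputable def sec (s : S) : P := (X.proj_surjective s).choose

theorem proj_sec (s : S) : X.proj (X.sec s) = s := (X.proj_surjective s).choose_spec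

theorem sec_bijective : Function.Bijective fun x : S × Γ => X.act x.2 (X.sec x.1) := by
  constructor
  · rintro ⟨s, g⟩ ⟨t, h⟩ e
    have e' : X.act g (X.sec s) = X.act h (X.sec t) := e
    have hp : ∀ g p, X.proj (X.act g p) = X.proj p := fun g p =>
      ((X.proj_eq_iff p _).mpr ⟨g, rfl⟩).symm
    have hst : s = t := by
      have := congrArg X.proj e'
      rwa [hp, hp, X.proj_sec, X.proj_sec] at this
    subst hst
    rw [X.act_left_injective _ e']
  · intro p
    obtain ⟨g, hg⟩ := (X.proj_eq_iff (X.sec (X.proj p)) p).mp (X.proj_sec _)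
    exact ⟨(X.proj p, g), hg⟩

theorem finite_n_left (q : P) (C : ℝ) : {p | X.n p q ≠ 0 ∧ X.A p < C}.Finite := by
  have := X.finite_base
  have hfin : ∀ s, {g | X.n (X.sec s) (X.act (-g) q) ≠ 0 ∧
      X.A q + X.A (X.sec s) - C < X.A (X.act (-g) q)}.Finite := fun s =>
    (X.finite_n_right (X.sec s) (X.A q + X.A (X.sec s) - C)).preimage
      (((X.act_left_injective q).comp neg_injective).injOn)
  refine (Set.finite_iUnion fun s => (hfin s).image fun g => X.act g (X.sec s)).subset ?_
  rintro p ⟨h, hC⟩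
  obtain ⟨⟨s, g⟩, rfl⟩ := X.sec_bijective.2 p
  dsimp only at h hC
  rw [X.n_act_left] at h
  rw [X.A_act] at hC
  exact Set.mem_iUnion.mpr ⟨s, g, ⟨h, by rw [X.A_act, map_neg]; linarith⟩, rfl⟩

/-- The coefficients of a chain along one fibre of the bundle, as a Novikov ring element. -/
noncomputable def coeffs (c : X.chains K) (s : S) : X.novikov K :=
  ⟨fun g => c.1 (X.act g (X.sec s)), by
    constructor
    · intro C
      refine ((c.2.1 (X.A (X.sec s) - C)).preimage (X.act_left_injective (X.sec s)).injOn).subset ?_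
      rintro g ⟨h, hC⟩
      exact ⟨h, by rw [X.A_act]; linarith⟩
    · refine (c.2.2.image fun k => X.gr (X.sec s) - k).subset ?_
      rintro _ ⟨g, h, rfl⟩
      exact ⟨_, ⟨_, h, rfl⟩, by rw [X.gr_act]; ring⟩⟩

theorem chain_eq_sum [Fintype S] (c : X.chains K) :
    c = ∑ s, X.novikovSMul (X.coeffs c s) (X.gen K (X.sec s)) := by
  classical
  refine Subtype.ext (funext fun p => ?_)
  rw [AddSubmonoidClass.coe_finsetSum, FormalSum.sum_apply]
  obtain ⟨⟨s, g⟩, rfl⟩ := X.sec_bijective.2 p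
  dsimp only
  have key : ∀ t h, (X.gen K (X.sec t)).1 (X.act (-h) (X.act g (X.sec s))) ≠ 0 →
      (s, g) = (t, h) := by
    intro t h hne
    have := X.eq_of_gen_ne_zero hne
    refine X.sec_bijective.1 ?_
    dsimp only
    rw [← this, X.act_neg_act]
  rw [Finset.sum_eq_single s]
  · change _ = ∑ᶠ h, c.1 (X.act h (X.sec s)) * _
    rw [finsum_eq_single _ g]
    · rw [X.neg_act_act, X.gen_self, mul_one]
    · intro h hh
      rw [not_imp_comm.mp (key s h) fun e => hh (Prod.ext_iff.mp e).2.symm, mul_zero]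
  · intro t _ ht
    change ∑ᶠ h, c.1 (X.act h (X.sec t)) * _ = 0
    rw [finsum_eq_single _ 0, not_imp_comm.mp (key t 0), mul_zero]
    · exact fun e => ht (Prod.ext_iff.mp e).1.symm
    · intro h _
      rw [not_imp_comm.mp (key t h) fun e => ht (Prod.ext_iff.mp e).1.symm, mul_zero]
  · simp

theorem finite_d_support (c : X.chains K) (q : P) : {p | c.1 p * X.n p q ≠ 0}.Finite :=
  (c.2.1 (X.A q)).subset fun _ h =>
    ⟨left_ne_zero_of_mul h, X.A_lt_of_n (right_ne_zero_of_mul h)⟩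

/-- The boundary operator is determined by its matrix coefficients. -/
theorem d_apply (c : X.chains K) (q : P) : (X.d c).1 q = ∑ᶠ p, c.1 p * X.n p q := by
  classical
  have := X.finite_base
  have := Fintype.ofFinite S
  conv_lhs => rw [X.chain_eq_sum c]
  rw [map_sum, AddSubmonoidClass.coe_finsetSum, FormalSum.sum_apply,
    ← finsum_comp (fun x : S × Γ => X.act x.2 (X.sec x.1)) X.sec_bijective, finsum_curry,
    finsum_eq_sum_of_fintype]
  · refine Finset.sum_congr rfl fun s _ => ?_
    rw [X.d_novikovSMul]
    refine finsum_congr fun g => ?_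
    rw [X.n_act_left]
    rfl
  · exact (X.finite_d_support c q).preimage X.sec_bijective.1.injOn

/-- The opposite boundary operator `δ`, the `Λ̄`-linear extension of `δ p = ∑ n(q, p) q`. -/
noncomputable def opD : X.op.chains K →ₗ[K] X.op.chains K where
  toFun c := ⟨fun q => ∑ᶠ p, c.1 p * X.n q p, by
    have key : ∀ q, ∑ᶠ p, c.1 p * X.n q p ≠ 0 → ∃ p, c.1 p ≠ 0 ∧ X.n q p ≠ 0 := by
      intro q h
      obtain ⟨p, hp⟩ := exists_ne_zero_of_finsum h
      exact ⟨p, left_ne_zero_of_mul hp, right_ne_zero_of_mul hp⟩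
    constructor
    · intro C
      refine ((c.2.1 C).biUnion fun p _ => X.finite_n_left p (-C)).subset ?_
      rintro q ⟨h, hC⟩
      obtain ⟨p, hp, hn⟩ := key q h
      have h1 := X.A_lt_of_n hn
      have hC' : C < -X.A q := hC
      exact Set.mem_biUnion (x := p) ⟨hp, show C < -X.A p by linarith⟩ ⟨hn, by linarith⟩
    · refine (c.2.2.image fun k => k - 1).subset ?_
      rintro _ ⟨q, h, rfl⟩
      obtain ⟨p, hp, hn⟩ := key q h
      refine ⟨_, ⟨p, hp, rfl⟩, ?_⟩
      change -X.gr p - 1 = -X.gr q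
      rw [X.gr_of_n hn]; ring⟩
  map_add' := by
    intro a b
    refine Subtype.ext (funext fun q => ?_)
    have hf : ∀ c : X.op.chains K, {p | c.1 p * X.n q p ≠ 0}.Finite := fun c =>
      (c.2.1 (-X.A q)).subset fun p h =>
        ⟨left_ne_zero_of_mul h, neg_lt_neg (X.A_lt_of_n (right_ne_zero_of_mul h))⟩
    change ∑ᶠ p, (a.1 p + b.1 p) * X.n q p = (∑ᶠ p, a.1 p * X.n q p) + ∑ᶠ p, b.1 p * X.n q p
    rw [← finsum_add_distrib (hf a) (hf b)]
    simp only [add_mul]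
  map_smul' := by
    intro t a
    refine Subtype.ext (funext fun q => ?_)
    change ∑ᶠ p, t * a.1 p * X.n q p = t * ∑ᶠ p, a.1 p * X.n q p
    rw [mul_finsum]
    simp only [mul_assoc]

theorem opD_apply (c : X.op.chains K) (q : P) : (X.opD c).1 q = ∑ᶠ p, c.1 p * X.n q p := rfl

theorem exists_of_opD {c : X.op.chains K} {q : P} (h : (X.opD c).1 q ≠ 0) :
    ∃ p, c.1 p ≠ 0 ∧ X.n q p ≠ 0 := by
  rw [opD_apply] at h
  obtain ⟨p, hp⟩ := exists_ne_zero_of_finsum h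
  exact ⟨p, left_ne_zero_of_mul hp, right_ne_zero_of_mul hp⟩

/-- The opposite complex. -/
noncomputable def op : FloerNovikovComplex K Γ P S where
  toFloerNovikovData := X.toFloerNovikovData.op
  d := X.opD
  d_novikovSMul := by
    intro b c
    refine Subtype.ext (funext fun q => ?_)
    change ∑ᶠ p, (∑ᶠ g, b.1 g * c.1 (X.act (- -g) p)) * X.n q p =
      ∑ᶠ g, b.1 g * ∑ᶠ p, c.1 p * X.n (X.act (- -g) q) p
    simp only [neg_neg, finsum_mul, mul_finsum]
    rw [finsum_swap]
    · refine finsum_congr fun g => ?_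
      refine finsum_eq_of_bijective (X.act g) (X.act_bijective g) fun p => ?_
      rw [X.n_act, mul_assoc]
    · obtain ⟨M, hM⟩ := X.toFloerNovikovData.op.chains_bddAbove c
      obtain ⟨m, hm⟩ := X.toFloerNovikovData.op.novikov_bddBelow b
      refine (((b.2.1 (X.A q + M)).prod (c.2.1 (m - X.A q))).image
        fun x => (X.act (-x.1) x.2, x.1)).subset ?_
      rintro ⟨p, g⟩ h
      have hn := X.A_lt_of_n (right_ne_zero_of_mul h)
      have hb : b.1 g ≠ 0 := left_ne_zero_of_mul (left_ne_zero_of_mul h)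
      have hc : c.1 (X.act g p) ≠ 0 := right_ne_zero_of_mul (left_ne_zero_of_mul h)
      have h1 : -X.A (X.act g p) ≤ M := hM _ hc
      have h2 : m ≤ X.ω g := hm g hb
      have h3 := X.A_act g p
      refine ⟨(g, X.act g p), ⟨⟨hb, show X.ω g < X.A q + M by linarith⟩,
        ⟨hc, show m - X.A q < -X.A (X.act g p) by linarith⟩⟩, ?_⟩
      dsimp only
      rw [X.neg_act_act]
  d_d := by
    intro c
    refine Subtype.ext (funext fun r => ?_)
    change ∑ᶠ q, (∑ᶠ p, c.1 p * X.n q p) * X.n r q = 0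
    simp only [finsum_mul]
    rw [finsum_swap]
    · have key : ∀ p, ∑ᶠ q, X.n r q * X.n q p = 0 := by
        intro p
        have h := X.d_apply (X.d (X.gen K r)) p
        rw [X.d_d] at h
        exact h.symm
      have : ∀ p, ∑ᶠ q, c.1 p * X.n q p * X.n r q = 0 := by
        intro p
        rw [← mul_zero (c.1 p), ← key p, mul_finsum]
        exact finsum_congr fun q => by ring
      simp only [this, finsum_zero]
    · refine ((c.2.1 (-X.A r)).biUnion fun p _ =>
        (X.finite_n_left p (X.A r)).image fun q => (q, p)).subset ?_
      rintro ⟨q, p⟩ h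
      have hc : c.1 p ≠ 0 := left_ne_zero_of_mul (left_ne_zero_of_mul h)
      have hn : X.n q p ≠ 0 := right_ne_zero_of_mul (left_ne_zero_of_mul h)
      have h1 := X.A_lt_of_n hn
      have h2 := X.A_lt_of_n (right_ne_zero_of_mul h)
      exact Set.mem_biUnion (x := p) ⟨hc, neg_lt_neg (h1.trans h2)⟩ ⟨q, ⟨hn, h2⟩, rfl⟩
  level_d_lt := by
    intro c hc
    obtain ⟨p₀, hp₀, e₀⟩ := X.toFloerNovikovData.op.exists_level_eq c hc
    by_cases h : X.opD c = 0
    · rw [h, e₀]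
      refine lt_of_eq_of_lt ?_ (EReal.bot_lt_coe _)
      exact iSup_eq_bot.mpr fun p => absurd rfl p.2
    · obtain ⟨q, hq, e⟩ := X.toFloerNovikovData.op.exists_level_eq _ h
      obtain ⟨p, hp, hn⟩ := X.exists_of_opD hq
      rw [e]
      refine lt_of_lt_of_le ?_ (X.toFloerNovikovData.op.le_level c hp)
      exact EReal.coe_lt_coe_iff.mpr (neg_lt_neg (X.A_lt_of_n hn))
  d_mem_graded := by
    intro k c hc q hq
    obtain ⟨p, hp, hn⟩ := X.exists_of_opD hq
    have h1 : -X.gr p = k := hc p hp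
    change -X.gr q = k - 1
    rw [← h1, X.gr_of_n hn]; ring

/-- The degree-`k` cycles. -/
def cycles (k : ℤ) : Submodule K (X.chains K) := X.graded K k ⊓ LinearMap.ker X.d

/-- The degree-`k` boundaries `∂ C_{k+1}`, inside the cycles. -/
def boundaries (k : ℤ) : Submodule K (X.cycles k) :=
  ((X.graded K (k + 1)).map X.d).submoduleOf (X.cycles k)

/-- The homology `H_k(C_*)`. -/
abbrev homology (k : ℤ) := X.cycles k ⧸ X.boundaries k

/-- The spectral number `ρ(a) = inf {ℓ(c) | [c] = a}`. -/
noncomputable def spectralNumber {k : ℤ} (a : X.homology k) : EReal :=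
  ⨅ c : {c : X.cycles k // (X.boundaries k).mkQ c = a}, X.level c.1.1

theorem finite_pairing_support (d : X.op.chains K) (c : X.chains K) :
    {p | d.1 p * c.1 p ≠ 0}.Finite := by
  obtain ⟨M, hM⟩ := X.toFloerNovikovData.op.chains_bddAbove d
  refine (c.2.1 (-M - 1)).subset fun p h => ⟨right_ne_zero_of_mul h, ?_⟩
  have : -X.A p ≤ M := hM p (left_ne_zero_of_mul h)
  linarith

/-- The pairing `Δ(∑ d_p p, ∑ c_p p) = ∑ d_p c_p` between `D_*` and `C_*`. -/
noncomputable def pairing : X.op.chains K →ₗ[K] X.chains K →ₗ[K] K :=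
  LinearMap.mk₂ K (fun d c => ∑ᶠ p, d.1 p * c.1 p)
    (fun d d' c => by
      rw [← finsum_add_distrib (X.finite_pairing_support d c) (X.finite_pairing_support d' c)]
      exact finsum_congr fun p => add_mul _ _ _)
    (fun t d c => by
      rw [smul_eq_mul, mul_finsum]
      exact finsum_congr fun p => mul_assoc _ _ _)
    (fun d c c' => by
      rw [← finsum_add_distrib (X.finite_pairing_support d c) (X.finite_pairing_support d c')]
      exact finsum_congr fun p => mul_add _ _ _)
    (fun t d c => by
      rw [smul_eq_mul, mul_finsum]
      exact finsum_congr fun p => mul_left_comm _ _ _)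

theorem pairing_apply (d : X.op.chains K) (c : X.chains K) :
    X.pairing d c = ∑ᶠ p, d.1 p * c.1 p := rfl

theorem pairing_d (d : X.op.chains K) (c : X.chains K) :
    X.pairing (X.op.d d) c = X.pairing d (X.d c) := by
  rw [pairing_apply, pairing_apply]
  simp only [X.d_apply]
  change ∑ᶠ q, (∑ᶠ p, d.1 p * X.n q p) * c.1 q = _
  simp only [finsum_mul, mul_finsum]
  rw [finsum_swap]
  · exact finsum_congr fun p => finsum_congr fun q => by ring
  · obtain ⟨M, hM⟩ := X.toFloerNovikovData.op.chains_bddAbove d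
    obtain ⟨M', hM'⟩ := X.chains_bddAbove c
    refine ((c.2.1 (-M)).prod (d.2.1 (-M'))).subset ?_
    rintro ⟨q, p⟩ h
    have hc : c.1 q ≠ 0 := right_ne_zero_of_mul h
    have hd : d.1 p ≠ 0 := left_ne_zero_of_mul (left_ne_zero_of_mul h)
    have h1 := X.A_lt_of_n (right_ne_zero_of_mul (left_ne_zero_of_mul h))
    have h2 : -X.A p ≤ M := hM p hd
    have h3 := hM' q hc
    exact ⟨⟨hc, by linarith⟩, ⟨hd, show -M' < -X.A p by linarith⟩⟩

/-- The pairing of a cycle of the opposite complex with homology classes. -/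
noncomputable def cyclePairing (k : ℤ) : X.op.cycles (-k) →ₗ[K] X.homology k →ₗ[K] K where
  toFun d := (X.boundaries k).liftQ ((X.pairing d.1).comp (X.cycles k).subtype) (by
    rintro ⟨_, hc⟩ ⟨x, _, rfl⟩
    change X.pairing d.1 (X.d x) = 0
    have hd : X.op.d d.1 = 0 := d.2.2
    rw [← X.pairing_d, hd, map_zero, LinearMap.zero_apply])
  map_add' d d' := by
    ext c
    exact LinearMap.map_add₂ X.pairing d.1 d'.1 c.1
  map_smul' t d := by
    ext c
    exact LinearMap.map_smul₂ X.pairing t d.1 c.1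

/-- The pairing `H_{-k}(D_*) × H_k(C_*) → K` induced by `Δ`. -/
noncomputable def homologyPairing (k : ℤ) : X.op.homology (-k) →ₗ[K] X.homology k →ₗ[K] K :=
  (X.op.boundaries (-k)).liftQ (X.cyclePairing k) (by
    rintro ⟨_, hd⟩ ⟨x, _, rfl⟩
    refine LinearMap.mem_ker.mpr ?_
    ext c
    change X.pairing (X.op.d x) c.1 = 0
    have hc : X.d c.1 = 0 := c.2.2
    rw [X.pairing_d, hc, map_zero])

theorem homologyPairing_mk (k : ℤ) (d : X.op.cycles (-k)) (c : X.cycles k) :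
    X.homologyPairing k ((X.op.boundaries (-k)).mkQ d) ((X.boundaries k).mkQ c) =
      ∑ᶠ p, d.1.1 p * c.1.1 p := rfl

end FloerNovikovComplex

/-!
Since `ω` is injective on `ker deg`, a series of elements of degree zero is the same as a series
with real exponents in `ω (ker deg)`, and each `C_k` becomes a finite-dimensional vector space over
the Novikov field of left-finite series of this kind. There `exp ℓ` is a non-Archimedean norm,
and one point of grading `k` from each fibre makes up an orthogonal basis.

Every subspace of such a space is the image of a linear projection that does not increase the norm;
this follows by induction on the dimension and uses only minima over the finite basis, so the value
group may be dense in `ℝ`. Projecting a cycle along the boundaries yields a representative `c` of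
`a` of minimal level and a functional `φ` that vanishes on boundaries, takes the value `1` on `c`
and has norm `exp (-ℓ(c))`. The constant term of `φ` is the pairing with a cycle `d` of the opposite
complex, and the norm of `φ` bounds the level of `d` by `-ℓ(c)`. Conversely, if `Δ(d, c) ≠ 0` then
some `p` occurs in both `d` and `c`, so that `-ℓ(d) ≤ 𝒜(p) ≤ ℓ(c)`.
-/

theorem isPWO_of_finite_inter_Iio {α : Type*} [LinearOrder α] {s : Set α}
    (hs : ∀ a, (s ∩ Set.Iio a).Finite) : s.IsPWO := by
  rw [Set.isPWO_iff_isWF, Set.isWF_iff_no_descending_seq]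
  intro f hf hmem
  have htail : Function.Injective fun n => f (n + 1) := hf.injective.comp (add_left_injective 1)
  refine Set.infinite_range_of_injective htail ((hs (f 0)).subset ?_)
  rintro _ ⟨n, rfl⟩
  exact ⟨hmem _, hf n.succ_pos⟩

theorem finite_inter_coe_lt {G : AddSubgroup ℝ} {s : Set G} (hs : ∀ a, (s ∩ Set.Iio a).Finite)
    (C : ℝ) : {x | x ∈ s ∧ (x : ℝ) < C}.Finite := by
  by_cases hC : ∃ a : G, C ≤ a
  · obtain ⟨a, ha⟩ := hC
    exact (hs a).subset fun x hx => ⟨hx.1, hx.2.trans_le ha⟩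
  · push Not at hC
    have not_pos (a : G) : ¬ 0 < a := fun ha => by
      obtain ⟨n, hn⟩ := Archimedean.arch C (show (0 : ℝ) < a from ha)
      exact (hC (n • a)).not_ge hn
    have : Subsingleton G := subsingleton_of_forall_eq 0 fun a =>
      le_antisymm (not_lt.mp (not_pos a)) (neg_nonpos.mp (not_lt.mp (not_pos (-a))))
    exact Set.toFinite _

theorem finsum_eq_finsum_comp_of_support_subset_range {α β M : Type*} [AddCommMonoid M]
    {e : α → β} (he : Function.Injective e) {f : β → M}
    (hf : Function.support f ⊆ Set.range e) : ∑ᶠ b, f b = ∑ᶠ a, f (e a) := by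
  rw [← finsum_mem_range he, finsum_mem_def, Set.indicator_eq_self.mpr hf]

theorem hahnSeries_coeff_mul_eq_finsum {G R : Type*} [AddCommGroup G] [PartialOrder G]
    [IsOrderedAddMonoid G] [NonUnitalNonAssocSemiring R] (x y : HahnSeries G R) (a : G) :
    (x * y).coeff a = ∑ᶠ i, x.coeff i * y.coeff (a - i) := by
  classical
  let s := Finset.antidiagonal x.isPWO_support y.isPWO_support a
  have snd_eq {ij : G × G} (h : ij ∈ s) : ij.2 = a - ij.1 :=
    eq_sub_of_add_eq' (Finset.mem_antidiagonal.mp h).2.2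
  have fst_injOn : Set.InjOn Prod.fst (s : Set (G × G)) := fun ij h ij' h' e =>
    Prod.ext e (by rw [snd_eq h, snd_eq h', e])
  rw [HahnSeries.coeff_mul, finsum_eq_sum_of_support_subset (s := s.image Prod.fst),
    Finset.sum_image fst_injOn]
  · exact Finset.sum_congr rfl fun ij h => by rw [snd_eq h]
  · intro i hi
    have hmem : (i, a - i) ∈ s := Finset.mem_antidiagonal.mpr
      ⟨left_ne_zero_of_mul hi, right_ne_zero_of_mul hi, add_sub_cancel _ _⟩
    exact Finset.mem_coe.mpr (Finset.mem_image_of_mem Prod.fst hmem)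

section WeightedOrder

variable {F ι Γ₀ : Type*} [Ring F] [LinearOrderedAddCommMonoidWithTop Γ₀] [Fintype ι]
  (v : AddValuation F Γ₀) (w : ι → Γ₀)

/-- The weighted order `min_i (v (x i) + w i)` of a vector: a non-Archimedean norm on `ι → F`,
written additively, so that long vectors have small order and `0` has order `⊤`. -/
def weightedOrder (x : ι → F) : Γ₀ := Finset.univ.inf fun i => v (x i) + w i

variable {v w}

theorem le_weightedOrder_iff {x : ι → F} {r : Γ₀} :
    r ≤ weightedOrder v w x ↔ ∀ i, r ≤ v (x i) + w i := by
  simp only [weightedOrder, Finset.le_inf_iff, Finset.mem_univ, true_imp_iff]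

theorem weightedOrder_le (x : ι → F) (i : ι) : weightedOrder v w x ≤ v (x i) + w i :=
  le_weightedOrder_iff.mp le_rfl i

theorem le_weightedOrder_add {x y : ι → F} {r : Γ₀} (hx : r ≤ weightedOrder v w x)
    (hy : r ≤ weightedOrder v w y) : r ≤ weightedOrder v w (x + y) := by
  rw [le_weightedOrder_iff] at hx hy ⊢
  intro i
  calc r ≤ min (v (x i) + w i) (v (y i) + w i) := le_min (hx i) (hy i)
    _ = min (v (x i)) (v (y i)) + w i := (min_add_add_right _ _ _)
    _ ≤ v (x i + y i) + w i := by gcongr; exact v.map_add _ _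

theorem le_weightedOrder_sub {x y : ι → F} {r : Γ₀} (hx : r ≤ weightedOrder v w x)
    (hy : r ≤ weightedOrder v w y) : r ≤ weightedOrder v w (x - y) := by
  rw [sub_eq_add_neg]
  refine le_weightedOrder_add hx (le_weightedOrder_iff.mpr fun i => ?_)
  rw [Pi.neg_apply, v.map_neg]
  exact le_weightedOrder_iff.mp hy i

theorem add_weightedOrder_le_weightedOrder_smul (a : F) (x : ι → F) :
    v a + weightedOrder v w x ≤ weightedOrder v w (a • x) :=
  le_weightedOrder_iff.mpr fun i => by
    rw [Pi.smul_apply, smul_eq_mul, v.map_mul, add_assoc]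
    gcongr
    exact weightedOrder_le x i

theorem exists_weightedOrder_eq {x : ι → F} (hx : x ≠ 0) :
    ∃ i, x i ≠ 0 ∧ weightedOrder v w x = v (x i) + w i := by
  obtain ⟨i, hi, hmin⟩ := Set.exists_min_image {i | x i ≠ 0} (fun i => v (x i) + w i)
    (Set.toFinite _) (Function.ne_iff.mp hx)
  refine ⟨i, hi, le_antisymm (weightedOrder_le x i) (le_weightedOrder_iff.mpr fun j => ?_)⟩
  by_cases hj : x j = 0
  · rw [hj, v.map_zero, top_add]
    exact le_top
  · exact hmin j hj

end WeightedOrder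

section OrthogonalProjection

variable {F ι Γ₀ : Type*} [DivisionRing F] [LinearOrderedAddCommMonoidWithTop Γ₀] [Fintype ι]
  {v : AddValuation F Γ₀} {w : ι → Γ₀}

theorem exists_dual_eq_one_of_ne_zero {u : ι → F} (hu : u ≠ 0) :
    ∃ ψ : (ι → F) →ₗ[F] F, ψ u = 1 ∧
      ∀ x, weightedOrder v w x ≤ v (ψ x) + weightedOrder v w u := by
  obtain ⟨i, hi, hui⟩ := exists_weightedOrder_eq (v := v) (w := w) hu
  refine ⟨(LinearMap.proj (φ := fun _ => F) i).smulRight (u i)⁻¹, ?_, fun x => ?_⟩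
  · exact mul_inv_cancel₀ hi
  calc weightedOrder v w x ≤ v (x i) + w i := weightedOrder_le x i
    _ = v (x i * (u i)⁻¹ * u i) + w i := by rw [inv_mul_cancel_right₀ hi]
    _ = v (x i * (u i)⁻¹) + weightedOrder v w u := by rw [hui, v.map_mul, add_assoc]

theorem exists_projection_le_weightedOrder (U : Submodule F (ι → F)) :
    ∃ Q : (ι → F) →ₗ[F] (ι → F), (∀ x, Q x ∈ U) ∧ (∀ x ∈ U, Q x = x) ∧
      ∀ x, weightedOrder v w x ≤ weightedOrder v w (Q x) := by
  induction hn : Module.finrank F U using Nat.strong_induction_on generalizing U with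
  | _ n ih =>
  subst hn
  obtain rfl | hU := eq_or_ne U ⊥
  · exact ⟨0, fun _ => rfl, fun x hx => ((Submodule.mem_bot F).mp hx).symm,
      fun x => le_weightedOrder_iff.mpr fun i => by simp⟩
  obtain ⟨u, huU, hu⟩ := Submodule.exists_mem_ne_zero_of_ne_bot hU
  obtain ⟨ψ, hψu, hψ⟩ := exists_dual_eq_one_of_ne_zero (v := v) (w := w) hu
  have order_le (x) : weightedOrder v w x ≤ weightedOrder v w (ψ x • u) :=
    (hψ x).trans (add_weightedOrder_le_weightedOrder_smul _ _)
  have hlt : U ⊓ LinearMap.ker ψ < U :=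
    inf_le_left.lt_of_not_ge fun h => one_ne_zero (hψu.symm.trans (h huU).2)
  obtain ⟨Q, hQmem, hQ, hQle⟩ := ih _ (Submodule.finrank_lt_finrank_of_lt hlt) _ rfl
  refine ⟨Q.comp (LinearMap.id - ψ.smulRight u) + ψ.smulRight u, fun x => ?_, fun x hx => ?_,
    fun x => ?_⟩
  · exact U.add_mem (hQmem _).1 (U.smul_mem _ huU)
  · have hker : x - ψ x • u ∈ U ⊓ LinearMap.ker ψ :=
      ⟨U.sub_mem hx (U.smul_mem _ huU), by simp [hψu]⟩
    change Q (x - ψ x • u) + ψ x • u = x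
    rw [hQ _ hker, sub_add_cancel]
  · exact le_weightedOrder_add ((le_weightedOrder_sub le_rfl (order_le x)).trans (hQle _))
      (order_le x)

/-- Since `φ = 1` on the coset `c + U`, the vector `c'` has the largest order in this coset. -/
theorem exists_dual_eq_one_vanishing_on (U : Submodule F (ι → F)) {c : ι → F} (hc : c ∉ U) :
    ∃ c', c' - c ∈ U ∧ ∃ φ : (ι → F) →ₗ[F] F, (∀ x ∈ U, φ x = 0) ∧ φ c = 1 ∧
      ∀ x, weightedOrder v w x ≤ v (φ x) + weightedOrder v w c' := by
  obtain ⟨Q, hQmem, hQ, hQle⟩ := exists_projection_le_weightedOrder (v := v) (w := w) U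
  have hc' : c - Q c ≠ 0 := fun h => hc (sub_eq_zero.mp h ▸ hQmem c)
  obtain ⟨ψ, hψc, hψ⟩ := exists_dual_eq_one_of_ne_zero (v := v) (w := w) hc'
  refine ⟨c - Q c, by simpa using hQmem c, ψ.comp (LinearMap.id - Q), fun x hx => ?_, hψc,
    fun x => (le_weightedOrder_sub le_rfl (hQle x)).trans (hψ (x - Q x))⟩
  change ψ (x - Q x) = 0
  rw [hQ x hx, sub_self, map_zero]

end OrthogonalProjection

section NovikovField

variable {G R : Type*}

/-- A Hahn series is left-finite if it has only finitely many terms below each exponent. -/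
def IsLeftFinite [PartialOrder G] [Zero R] (f : HahnSeries G R) : Prop :=
  ∀ a, (f.support ∩ Set.Iio a).Finite

namespace IsLeftFinite

theorem of_support_subset [PartialOrder G] [Zero R] {f g : HahnSeries G R} (hg : IsLeftFinite g)
    (h : f.support ⊆ g.support) : IsLeftFinite f :=
  fun a => (hg a).subset (Set.inter_subset_inter_left _ h)

theorem of_finite_support [PartialOrder G] [Zero R] {f : HahnSeries G R} (h : f.support.Finite) :
    IsLeftFinite f :=
  fun _ => h.subset Set.inter_subset_left

theorem single [PartialOrder G] [Zero R] (a : G) (r : R) : IsLeftFinite (HahnSeries.single a r) :=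
  of_finite_support ((Set.finite_singleton a).subset HahnSeries.support_single_subset)

theorem add [PartialOrder G] [AddMonoid R] {f g : HahnSeries G R} (hf : IsLeftFinite f)
    (hg : IsLeftFinite g) : IsLeftFinite (f + g) := fun a =>
  ((hf a).union (hg a)).subset <| by
    rw [← Set.union_inter_distrib_right]
    exact Set.inter_subset_inter_left _ (HahnSeries.support_add_subset f g)

theorem neg [PartialOrder G] [AddGroup R] {f : HahnSeries G R} (hf : IsLeftFinite f) :
    IsLeftFinite (-f) :=
  hf.of_support_subset (HahnSeries.support_neg_subset f)

variable [AddCommGroup G] [LinearOrder G] [IsOrderedAddMonoid G]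

theorem mul [NonUnitalNonAssocSemiring R] {f g : HahnSeries G R} (hf : IsLeftFinite f)
    (hg : IsLeftFinite g) : IsLeftFinite (f * g) := fun a => by
  refine ((hf (a - g.order)).add (hg (a - f.order))).subset ?_
  rintro _ ⟨hx, hlt⟩
  obtain ⟨i, hi, j, hj, rfl⟩ := HahnSeries.support_mul_subset hx
  have hi' : f.order ≤ i := HahnSeries.order_le_of_coeff_ne_zero hi
  have hj' : g.order ≤ j := HahnSeries.order_le_of_coeff_ne_zero hj
  exact Set.add_mem_add ⟨hi, lt_sub_iff_add_lt.mpr ((add_le_add_right hj' i).trans_lt hlt)⟩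
    ⟨hj, lt_sub_iff_add_lt'.mpr ((add_le_add_left hi' j).trans_lt hlt)⟩

theorem pow [Semiring R] {f : HahnSeries G R} (hf : IsLeftFinite f) :
    ∀ n : ℕ, IsLeftFinite (f ^ n)
  | 0 => by rw [pow_zero]; exact single 0 1
  | n + 1 => by rw [pow_succ]; exact (pow hf n).mul hf

theorem hsum_powers [Archimedean G] [CommRing R] {f : HahnSeries G R} (hf : IsLeftFinite f)
    (hpos : 0 < f.orderTop) : IsLeftFinite (HahnSeries.SummableFamily.powers f).hsum := fun a => by
  obtain ⟨N, hN⟩ : ∃ N : ℕ, (a : WithTop G) ≤ N • f.orderTop := by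
    cases h : f.orderTop with
    | top => exact ⟨1, by simp⟩
    | coe ε =>
      obtain ⟨N, hN⟩ := Archimedean.arch a (WithTop.coe_pos.mp (h ▸ hpos))
      exact ⟨N, by exact_mod_cast hN⟩
  refine ((Set.finite_Iio N).biUnion fun n _ => hf.pow n a).subset ?_
  rintro x ⟨hx, hlt⟩
  obtain ⟨n, hn⟩ := Set.mem_iUnion.mp (HahnSeries.SummableFamily.support_hsum_subset hx)
  rw [HahnSeries.SummableFamily.powers_of_orderTop_pos hpos] at hn
  refine Set.mem_biUnion (Set.mem_Iio.mpr (lt_of_not_ge fun hNn => ?_)) ⟨hn, hlt⟩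
  refine hlt.not_ge (WithTop.coe_le_coe.mp ?_)
  calc (a : WithTop G) ≤ N • f.orderTop := hN
    _ ≤ n • f.orderTop := nsmul_le_nsmul_left hpos.le hNn
    _ ≤ (f ^ n).orderTop := HahnSeries.orderTop_nsmul_le_orderTop_pow
    _ ≤ x := HahnSeries.orderTop_le_of_coeff_ne_zero hn

theorem inv [Archimedean G] [Field R] {f : HahnSeries G R} (hf : IsLeftFinite f) :
    IsLeftFinite f⁻¹ := by
  obtain rfl | hf0 := eq_or_ne f 0
  · rwa [inv_zero]
  rw [HahnSeries.inv_def]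
  refine (single _ _).mul (hsum_powers ?_ ?_)
  · rw [sub_eq_add_neg]
    exact (single 0 1).add ((single _ _).mul hf).neg
  · exact HahnSeries.unit_aux f (inv_mul_cancel₀ (HahnSeries.leadingCoeff_ne_zero.mpr hf0)) _
      (neg_add_cancel f.order)

end IsLeftFinite

variable (G R) in
/-- The Novikov field: the left-finite Hahn series over an Archimedean ordered group. Inverses
are given by geometric series, whose left-finiteness is the Archimedean property. -/
def novikovField [AddCommGroup G] [LinearOrder G] [IsOrderedAddMonoid G] [Archimedean G] [Field R] :
    Subfield (HahnSeries G R) where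
  carrier := {f | IsLeftFinite f}
  mul_mem' := IsLeftFinite.mul
  one_mem' := IsLeftFinite.single 0 1
  add_mem' := IsLeftFinite.add
  zero_mem' := .of_finite_support (by simp)
  neg_mem' := IsLeftFinite.neg
  inv_mem' _ := IsLeftFinite.inv

/- A shortcut: without it, instance search gets lost among the scalar actions of subfields. -/
noncomputable instance {ι : Type*} [AddCommGroup G] [LinearOrder G] [IsOrderedAddMonoid G]
    [Archimedean G] [Field R] : SMul (novikovField G R) (ι → novikovField G R) :=
  Pi.instSMul

/-- The valuation of the Novikov field with exponents in a subgroup of `ℝ`: the exponent of the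
lowest term, as a real number, and `⊤` for the zero series. -/
noncomputable def novikovOrder (G : AddSubgroup ℝ) (K : Type*) [Field K] :
    AddValuation (novikovField G K) (WithTop ℝ) :=
  ((HahnSeries.addVal G K).map G.subtype.withTopMap rfl
    (WithTop.monotone_map_iff.mpr (Subtype.mono_coe _))).comap (novikovField G K).subtype

theorem novikovOrder_le_of_coeff_ne_zero {G : AddSubgroup ℝ} {K : Type*} [Field K]
    {f : novikovField G K} {x : G} (hx : f.1.coeff x ≠ 0) : novikovOrder G K f ≤ (x : ℝ) :=
  WithTop.monotone_map_iff.mpr (Subtype.mono_coe _) (HahnSeries.addVal_le_of_coeff_ne_zero hx)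

theorem coe_le_novikovOrder_iff {G : AddSubgroup ℝ} {K : Type*} [Field K] {f : novikovField G K}
    {r : ℝ} : (r : WithTop ℝ) ≤ novikovOrder G K f ↔ ∀ x, f.1.coeff x ≠ 0 → r ≤ x := by
  obtain rfl | hf := eq_or_ne f 0
  · simp
  refine ⟨fun h x hx => WithTop.coe_le_coe.mp (h.trans (novikovOrder_le_of_coeff_ne_zero hx)),
    fun h => ?_⟩
  have hf' : f.1 ≠ 0 := Subtype.coe_ne_coe.mpr hf
  calc (r : WithTop ℝ) ≤ (f.1.order : ℝ) :=
        WithTop.coe_le_coe.mpr (h _ (HahnSeries.coeff_order_eq_zero.not.mpr hf'))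
    _ = novikovOrder G K f :=
        (congrArg G.subtype.withTopMap (HahnSeries.addVal_apply_of_ne hf')).symm

end NovikovField

namespace FloerNovikovData

variable {Γ P S : Type*} [AddCommGroup Γ] (X : FloerNovikovData Γ P S)

section Points

/-- The group `ω(ker deg)` of periods of elements of degree zero; the coefficients of `C_k` are
series with exponents in it. -/
def periodGroup : AddSubgroup ℝ := X.deg.ker.map X.ω

/-- An element of degree zero with the given period, unique if `ω` is injective on `ker deg`. -/
noncomputable def periodLift (x : X.periodGroup) : Γ := (AddSubgroup.mem_map.mp x.2).choose

theorem deg_periodLift (x : X.periodGroup) : X.deg (X.periodLift x) = 0 :=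
  (AddSubgroup.mem_map.mp x.2).choose_spec.1

theorem ω_periodLift (x : X.periodGroup) : X.ω (X.periodLift x) = x :=
  (AddSubgroup.mem_map.mp x.2).choose_spec.2

theorem periodLift_injective : Function.Injective X.periodLift := fun x y h =>
  Subtype.ext (by rw [← X.ω_periodLift, h, X.ω_periodLift])

theorem ω_mem_periodGroup {g : Γ} (hg : X.deg g = 0) : X.ω g ∈ X.periodGroup :=
  AddSubgroup.mem_map.mpr ⟨g, hg, rfl⟩

/-- The points of the base whose fibre contains elements of grading `k`. They index a basis of
`C_k` over the Novikov field. -/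
def GradedBase (k : ℤ) := {s : S // ∃ p, X.proj p = s ∧ X.gr p = k}

noncomputable instance (k : ℤ) : Fintype (X.GradedBase k) :=
  have := X.finite_base
  have : Finite (X.GradedBase k) := Subtype.finite
  Fintype.ofFinite _

variable {k : ℤ}

/-- A chosen point of grading `k` in the fibre over `s`. -/
noncomputable def basePoint (s : X.GradedBase k) : P := s.2.choose

theorem proj_basePoint (s : X.GradedBase k) : X.proj (X.basePoint s) = s.1 := s.2.choose_spec.1

theorem gr_basePoint (s : X.GradedBase k) : X.gr (X.basePoint s) = k := s.2.choose_spec.2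

/-- The translate of the base point over `s` by an element of degree zero with period `x`. -/
noncomputable def point (s : X.GradedBase k) (x : X.periodGroup) : P :=
  X.act (X.periodLift x) (X.basePoint s)

theorem proj_point (s : X.GradedBase k) (x : X.periodGroup) : X.proj (X.point s x) = s.1 :=
  ((X.proj_eq_iff _ _).mpr ⟨_, rfl⟩).symm.trans (X.proj_basePoint s)

theorem A_point (s : X.GradedBase k) (x : X.periodGroup) :
    X.A (X.point s x) = X.A (X.basePoint s) - x := by
  rw [point, X.A_act, ω_periodLift]

theorem gr_point (s : X.GradedBase k) (x : X.periodGroup) : X.gr (X.point s x) = k := by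
  rw [point, X.gr_act, deg_periodLift, gr_basePoint, sub_zero]

theorem point_right_injective (s : X.GradedBase k) : Function.Injective (X.point s) :=
  (X.act_left_injective _).comp X.periodLift_injective

variable (k) in
theorem uncurry_point_injective :
    Function.Injective (Function.uncurry (X.point (k := k))) := by
  rintro ⟨s, x⟩ ⟨t, y⟩ h
  obtain rfl : s = t :=
    Subtype.ext ((X.proj_point s x).symm.trans ((congrArg X.proj h).trans (X.proj_point t y)))
  exact congrArg (Prod.mk s) (X.point_right_injective s h)

variable {X}

theorem periodLift_ω (hinj : Set.InjOn X.ω {g : Γ | X.deg g = 0}) {g : Γ} (hg : X.deg g = 0) :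
    X.periodLift ⟨X.ω g, X.ω_mem_periodGroup hg⟩ = g :=
  hinj (X.deg_periodLift _) hg (X.ω_periodLift _)

theorem act_neg_periodLift_point (hinj : Set.InjOn X.ω {g : Γ | X.deg g = 0})
    (s : X.GradedBase k) (x y : X.periodGroup) :
    X.act (-X.periodLift y) (X.point s x) = X.point s (x - y) := by
  have hlift : -X.periodLift y + X.periodLift x = X.periodLift (x - y) := by
    refine hinj ?_ (X.deg_periodLift _) ?_
    · simp only [Set.mem_ofPred_eq, map_add, map_neg, deg_periodLift, neg_zero, add_zero]
    · simp only [map_add, map_neg, ω_periodLift, AddSubgroup.coe_sub]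
      ring
  rw [point, ← X.add_act, hlift, point]

theorem exists_point_eq (hinj : Set.InjOn X.ω {g : Γ | X.deg g = 0}) {p : P} (hp : X.gr p = k) :
    ∃ (s : X.GradedBase k) (x : X.periodGroup), X.point s x = p := by
  let s : X.GradedBase k := ⟨X.proj p, p, rfl, hp⟩
  obtain ⟨g, hg⟩ := (X.proj_eq_iff (X.basePoint s) p).mp (X.proj_basePoint s)
  have hdeg : X.deg g = 0 := by
    have hgr := X.gr_act g (X.basePoint s)
    rw [hg, gr_basePoint, hp] at hgr
    linarith
  exact ⟨s, ⟨X.ω g, X.ω_mem_periodGroup hdeg⟩, by rw [point, periodLift_ω hinj hdeg, hg]⟩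

end Points

section Coordinates

variable (K : Type*) [Field K]

/-- The Novikov field of the degree-zero part of `Γ`: the scalars over which each `C_k` is a
finite-dimensional vector space. -/
noncomputable abbrev scalars : Subfield (HahnSeries X.periodGroup K) := novikovField X.periodGroup K

variable {K}

theorem finite_coeff_point_ne_zero {k : ℤ} (c : X.chains K) (s : X.GradedBase k)
    (a : X.periodGroup) : ({x | c.1 (X.point s x) ≠ 0} ∩ Set.Iio a).Finite := by
  refine ((c.2.1 (X.A (X.point s a))).preimage (X.point_right_injective s).injOn).subset ?_
  rintro x ⟨hx, hxa⟩
  refine ⟨hx, ?_⟩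
  rw [A_point, A_point]
  exact sub_lt_sub_left hxa _

/-- The coordinates of the degree-`k` part of a chain with respect to the base points: the
coefficient of `point s x` becomes the coefficient of exponent `x` in the coordinate at `s`.
If `ω` is injective on `ker deg`, they identify `C_k` with a vector space over the Novikov field. -/
noncomputable def coords (k : ℤ) : X.chains K →+ (X.GradedBase k → X.scalars K) where
  toFun c s := ⟨⟨fun x => c.1 (X.point s x),
    isPWO_of_finite_inter_Iio (X.finite_coeff_point_ne_zero c s)⟩,
    X.finite_coeff_point_ne_zero c s⟩
  map_zero' := rfl
  map_add' _ _ := rfl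

variable {k : ℤ}

theorem coeff_coords (c : X.chains K) (s : X.GradedBase k) (x : X.periodGroup) :
    (X.coords k c s).1.coeff x = c.1 (X.point s x) := rfl

open Classical in
theorem coords_gen_point (s : X.GradedBase k) (x : X.periodGroup) :
    X.coords k (X.gen K (X.point s x)) =
      (⟨HahnSeries.single x 1, IsLeftFinite.single x 1⟩ : X.scalars K) • Pi.single s 1 := by
  rw [← Pi.single_smul, smul_eq_mul, mul_one]
  funext t
  refine Subtype.ext (HahnSeries.ext (funext fun y => ?_))
  rw [coeff_coords]
  by_cases h : (t, y) = (s, x)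
  · obtain ⟨rfl, rfl⟩ := Prod.ext_iff.mp h
    rw [gen_self, Pi.single_eq_same, HahnSeries.coeff_single_same]
  · have hne : X.point t y ≠ X.point s x := fun e => h (X.uncurry_point_injective k e)
    rw [not_imp_comm.mp X.eq_of_gen_ne_zero hne]
    obtain rfl | ht := eq_or_ne t s
    · rw [Pi.single_eq_same, HahnSeries.coeff_single_of_ne fun e => h (by rw [e])]
    · rw [Pi.single_eq_of_ne ht]
      rfl

theorem coords_gen_of_gr_ne {p : P} (hp : X.gr p ≠ k) : X.coords k (X.gen K p) = 0 := by
  funext t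
  refine Subtype.ext (HahnSeries.ext (funext fun y => ?_))
  exact not_imp_comm.mp X.eq_of_gen_ne_zero fun e => hp (by rw [← e, gr_point])

variable (k) in
/-- The weighted order on coordinate vectors that corresponds to `-ℓ` on chains. -/
noncomputable def coordsOrder (y : X.GradedBase k → X.scalars K) : WithTop ℝ :=
  weightedOrder (novikovOrder X.periodGroup K) (fun s => ((-X.A (X.basePoint s) : ℝ) : WithTop ℝ)) y

theorem coe_le_coordsOrder_coords_iff {c : X.chains K} {r : ℝ} :
    (r : WithTop ℝ) ≤ X.coordsOrder k (X.coords k c) ↔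
      ∀ s x, c.1 (X.point (k := k) s x) ≠ 0 → r ≤ -X.A (X.point s x) := by
  rw [coordsOrder, le_weightedOrder_iff]
  refine forall_congr' fun s => ?_
  have move_weight (t : WithTop ℝ) (a : ℝ) : (r : WithTop ℝ) ≤ t + (-a : ℝ) ↔ (r + a : ℝ) ≤ t := by
    cases t with
    | top => simp only [top_add, le_top]
    | coe t => rw [← WithTop.coe_add, WithTop.coe_le_coe, WithTop.coe_le_coe, le_add_neg_iff_add_le]
  rw [move_weight, coe_le_novikovOrder_iff]
  refine forall₂_congr fun x _ => ?_
  rw [A_point, neg_sub, le_sub_iff_add_le]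

variable {X}

theorem eq_zero_of_coords_eq_zero (hinj : Set.InjOn X.ω {g : Γ | X.deg g = 0})
    {c : X.chains K} (hc : c ∈ X.graded K k) (h : X.coords k c = 0) : c = 0 := by
  refine Subtype.ext (funext fun p => ?_)
  by_contra hp
  obtain ⟨s, x, rfl⟩ := exists_point_eq hinj (hc p hp)
  exact hp (by rw [← coeff_coords, h]; rfl)

end Coordinates

section ScalarAction

variable {X} {K : Type*} [Field K] {k : ℤ}

theorem exists_of_dite_coeff_ne_zero {f : X.scalars K} {g : Γ} [Decidable (X.deg g = 0)]
    (h : (if hg : X.deg g = 0 then f.1.coeff ⟨X.ω g, X.ω_mem_periodGroup hg⟩ else 0) ≠ 0) :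
    ∃ hg : X.deg g = 0, f.1.coeff ⟨X.ω g, X.ω_mem_periodGroup hg⟩ ≠ 0 := by
  split_ifs at h with hg
  · exact ⟨hg, h⟩
  · exact absurd rfl h

open Classical in
/-- A series in the Novikov field as an element of the Novikov ring `Λ̄`, supported in degree
zero. -/
noncomputable def ofSeries (hinj : Set.InjOn X.ω {g : Γ | X.deg g = 0}) (f : X.scalars K) :
    X.novikov K :=
  ⟨fun g => if hg : X.deg g = 0 then f.1.coeff ⟨X.ω g, X.ω_mem_periodGroup hg⟩ else 0, by
    constructor
    · intro C
      refine ((finite_inter_coe_lt f.2 C).image X.periodLift).subset ?_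
      rintro g ⟨h, hC⟩
      obtain ⟨hg, hf⟩ := exists_of_dite_coeff_ne_zero h
      exact ⟨_, ⟨hf, hC⟩, periodLift_ω hinj hg⟩
    · refine (Set.finite_singleton 0).subset ?_
      rintro _ ⟨g, h, rfl⟩
      exact (exists_of_dite_coeff_ne_zero h).1⟩

theorem deg_eq_zero_of_ofSeries_ne_zero (hinj : Set.InjOn X.ω {g : Γ | X.deg g = 0})
    {f : X.scalars K} {g : Γ} (h : (ofSeries hinj f).1 g ≠ 0) : X.deg g = 0 :=
  (exists_of_dite_coeff_ne_zero h).1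

theorem ofSeries_periodLift (hinj : Set.InjOn X.ω {g : Γ | X.deg g = 0}) (f : X.scalars K)
    (x : X.periodGroup) : (ofSeries hinj f).1 (X.periodLift x) = f.1.coeff x :=
  (dif_pos (X.deg_periodLift x)).trans (congrArg _ (Subtype.ext (X.ω_periodLift x)))

theorem ofSeries_smul_mem_graded (hinj : Set.InjOn X.ω {g : Γ | X.deg g = 0}) (f : X.scalars K)
    {c : X.chains K} (hc : c ∈ X.graded K k) :
    X.novikovSMul (ofSeries hinj f) c ∈ X.graded K k := by
  intro p hp
  obtain ⟨g, hg⟩ := exists_ne_zero_of_finsum (f := fun g => _ * c.1 (X.act (-g) p)) hp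
  have hgr := hc _ (right_ne_zero_of_mul hg)
  rwa [X.gr_act, map_neg, deg_eq_zero_of_ofSeries_ne_zero hinj (left_ne_zero_of_mul hg), neg_zero,
    sub_zero] at hgr

variable (k) in
theorem coords_ofSeries_smul (hinj : Set.InjOn X.ω {g : Γ | X.deg g = 0}) (f : X.scalars K)
    (c : X.chains K) : X.coords k (X.novikovSMul (ofSeries hinj f) c) = f • X.coords k c := by
  funext s
  refine Subtype.ext (HahnSeries.ext (funext fun x => ?_))
  change ∑ᶠ g, (ofSeries hinj f).1 g * c.1 (X.act (-g) (X.point s x)) =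
    (f.1 * (X.coords k c s).1).coeff x
  rw [hahnSeries_coeff_mul_eq_finsum,
    finsum_eq_finsum_comp_of_support_subset_range X.periodLift_injective]
  · refine finsum_congr fun y => ?_
    rw [ofSeries_periodLift, act_neg_periodLift_point hinj, coeff_coords]
  · intro g hg
    exact ⟨_, periodLift_ω hinj (deg_eq_zero_of_ofSeries_ne_zero hinj (left_ne_zero_of_mul hg))⟩

end ScalarAction

end FloerNovikovData

namespace FloerNovikovComplex

open FloerNovikovData

variable {K Γ P S : Type*} [Field K] [AddCommGroup Γ] {X : FloerNovikovComplex K Γ P S} {k : ℤ}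

section DualChain

variable (φ : (X.GradedBase k → X.scalars K) →ₗ[X.scalars K] X.scalars K)

open Classical in
theorem coeff_apply_coords_gen_point (s : X.GradedBase k) (x y : X.periodGroup) :
    (φ (X.coords k (X.gen K (X.point s x)))).1.coeff y = (φ (Pi.single s 1)).1.coeff (y - x) := by
  rw [coords_gen_point, map_smul]
  change (HahnSeries.single x 1 * (φ (Pi.single s 1)).1).coeff y = _
  rw [HahnSeries.coeff_single_mul, one_mul]

theorem gr_eq_of_apply_coords_gen_ne_zero {p : P} {y : X.periodGroup}
    (h : (φ (X.coords k (X.gen K p))).1.coeff y ≠ 0) : X.gr p = k := by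
  by_contra hp
  exact h (by rw [X.coords_gen_of_gr_ne hp, map_zero]; rfl)

theorem finite_coeff_apply_coords_gen_ne_zero (hinj : Set.InjOn X.ω {g : Γ | X.deg g = 0}) (C : ℝ) :
    {p | (φ (X.coords k (X.gen K p))).1.coeff 0 ≠ 0 ∧ C < -X.A p}.Finite := by
  classical
  have hfin (s : X.GradedBase k) := finite_inter_coe_lt (φ (Pi.single s 1)).2
    (-X.A (X.basePoint s) - C)
  refine (Set.finite_iUnion fun s => (hfin s).image fun y => X.point s (-y)).subset ?_
  rintro p ⟨h, hC⟩
  obtain ⟨s, x, rfl⟩ := exists_point_eq hinj (gr_eq_of_apply_coords_gen_ne_zero φ h)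
  rw [coeff_apply_coords_gen_point, zero_sub] at h
  rw [A_point] at hC
  refine Set.mem_iUnion.mpr ⟨s, -x, ⟨h, ?_⟩, by simp only [neg_neg]⟩
  rw [AddSubgroup.coe_neg]
  linarith

/-- The chain of the opposite complex that pairs with a chain `c` to the constant term of
`φ (coords k c)`. -/
noncomputable def dualChain (hinj : Set.InjOn X.ω {g : Γ | X.deg g = 0}) : X.op.chains K :=
  ⟨fun p => (φ (X.coords k (X.gen K p))).1.coeff 0, finite_coeff_apply_coords_gen_ne_zero φ hinj, by
    refine (Set.finite_singleton (-k)).subset ?_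
    rintro _ ⟨p, h, rfl⟩
    exact congrArg Neg.neg (gr_eq_of_apply_coords_gen_ne_zero φ h)⟩

theorem dualChain_apply (hinj : Set.InjOn X.ω {g : Γ | X.deg g = 0}) (p : P) :
    (dualChain φ hinj).1 p = (φ (X.coords k (X.gen K p))).1.coeff 0 := rfl

theorem dualChain_mem_graded (hinj : Set.InjOn X.ω {g : Γ | X.deg g = 0}) :
    dualChain φ hinj ∈ X.op.graded K (-k) :=
  fun _ hp => congrArg Neg.neg (gr_eq_of_apply_coords_gen_ne_zero φ hp)

end DualChain

section Pairing

variable (X) in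
theorem pairing_gen (d : X.op.chains K) (p : P) : X.pairing d (X.gen K p) = d.1 p := by
  rw [pairing_apply, finsum_eq_single _ p, gen_self, mul_one]
  intro q hq
  rw [not_imp_comm.mp X.eq_of_gen_ne_zero hq, mul_zero]

theorem pairing_dualChain (φ : (X.GradedBase k → X.scalars K) →ₗ[X.scalars K] X.scalars K)
    (hinj : Set.InjOn X.ω {g : Γ | X.deg g = 0}) (c : X.chains K) :
    X.pairing (dualChain φ hinj) c = (φ (X.coords k c)).1.coeff 0 := by
  classical
  have hφ : φ (X.coords k c) = ∑ s, X.coords k c s * φ (Pi.single s 1) := by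
    conv_lhs => rw [pi_eq_sum_univ' (X.coords k c), map_sum]
    exact Finset.sum_congr rfl fun s _ => φ.map_smul _ _
  rw [pairing_apply, finsum_eq_finsum_comp_of_support_subset_range
    (X.uncurry_point_injective k), finsum_curry, finsum_eq_sum_of_fintype, hφ,
    AddSubmonoidClass.coe_finsetSum, HahnSeries.coeff_sum]
  · refine Finset.sum_congr rfl fun s _ => ?_
    change _ = ((X.coords k c s).1 * (φ (Pi.single s 1)).1).coeff 0
    rw [hahnSeries_coeff_mul_eq_finsum]
    refine finsum_congr fun x => ?_
    rw [Function.uncurry_apply_pair, dualChain_apply, coeff_apply_coords_gen_point, coeff_coords,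
      mul_comm]
  · exact (X.finite_pairing_support _ c).preimage (X.uncurry_point_injective k).injOn
  · intro p hp
    have hgr := dualChain_mem_graded φ hinj p (left_ne_zero_of_mul hp)
    obtain ⟨s, x, hx⟩ := exists_point_eq hinj (neg_injective hgr)
    exact ⟨(s, x), hx⟩

theorem neg_level_op_le_level_of_pairing_ne_zero {d : X.op.chains K} {c : X.chains K}
    (h : X.pairing d c ≠ 0) : -X.op.level d ≤ X.level c := by
  rw [pairing_apply] at h
  obtain ⟨p, hp⟩ := exists_ne_zero_of_finsum h
  refine le_trans ?_ (X.le_level c (right_ne_zero_of_mul hp))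
  rw [EReal.neg_le]
  exact X.op.le_level d (left_ne_zero_of_mul hp)

variable (X) in
theorem neg_spectralNumber_op_le {a : X.homology k} {b : X.op.homology (-k)}
    (h : X.homologyPairing k b a ≠ 0) : -X.op.spectralNumber b ≤ X.spectralNumber a := by
  refine le_iInf ?_
  rintro ⟨c, rfl⟩
  rw [EReal.neg_le]
  refine le_iInf ?_
  rintro ⟨d, rfl⟩
  rw [EReal.neg_le]
  exact neg_level_op_le_level_of_pairing_ne_zero h

variable (X) in
theorem spectralNumber_mkQ_le (c : X.cycles k) :
    X.spectralNumber ((X.boundaries k).mkQ c) ≤ X.level c.1 :=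
  iInf_le_of_le ⟨c, rfl⟩ le_rfl

variable (X) in
theorem level_lt_top (c : X.chains K) : X.level c < ⊤ := by
  obtain ⟨M, hM⟩ := X.chains_bddAbove c
  exact (iSup_le fun p : {p // c.1 p ≠ 0} => EReal.coe_le_coe_iff.mpr (hM p.1 p.2)).trans_lt
    (EReal.coe_lt_top M)

end Pairing

section Duality

theorem d_mem_cycles {c : X.chains K} (hc : c ∈ X.graded K (k + 1)) : X.d c ∈ X.cycles k :=
  ⟨(add_sub_cancel_right k 1) ▸ X.d_mem_graded _ _ hc, X.d_d c⟩

/-- The boundaries `∂ C_{k+1}` in coordinates: a subspace over the Novikov field because `∂` is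
`Λ̄`-linear. -/
noncomputable def boundaryCoords (k : ℤ) (hinj : Set.InjOn X.ω {g : Γ | X.deg g = 0}) :
    Submodule (X.scalars K) (X.GradedBase k → X.scalars K) where
  carrier := {y | ∃ x ∈ X.graded K (k + 1), X.coords k (X.d x) = y}
  zero_mem' := ⟨0, Submodule.zero_mem _, by rw [map_zero, map_zero]⟩
  add_mem' := by
    rintro _ _ ⟨x, hx, rfl⟩ ⟨y, hy, rfl⟩
    exact ⟨x + y, Submodule.add_mem _ hx hy, by rw [map_add, map_add]⟩
  smul_mem' := by
    rintro f _ ⟨x, hx, rfl⟩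
    refine ⟨_, ofSeries_smul_mem_graded hinj f hx, ?_⟩
    rw [X.d_novikovSMul, coords_ofSeries_smul]

theorem coords_notMem_boundaryCoords (hinj : Set.InjOn X.ω {g : Γ | X.deg g = 0})
    {c : X.cycles k} (hc : (X.boundaries k).mkQ c ≠ 0) :
    X.coords k c.1 ∉ boundaryCoords k hinj := by
  rintro ⟨x, hx, e⟩
  refine hc ((Submodule.Quotient.mk_eq_zero _).mpr ⟨x, hx, sub_eq_zero.mp ?_⟩)
  refine eq_zero_of_coords_eq_zero hinj (Submodule.sub_mem _ (d_mem_cycles hx).1 c.2.1) ?_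
  rw [map_sub, e, Submodule.subtype_apply, sub_self]

theorem dualChain_mem_cycles {hinj : Set.InjOn X.ω {g : Γ | X.deg g = 0}}
    {φ : (X.GradedBase k → X.scalars K) →ₗ[X.scalars K] X.scalars K}
    (hφ : ∀ y ∈ boundaryCoords k hinj, φ y = 0) : dualChain φ hinj ∈ X.op.cycles (-k) := by
  refine ⟨dualChain_mem_graded φ hinj, Subtype.ext (funext fun q => ?_)⟩
  change (X.op.d (dualChain φ hinj)).1 q = 0
  by_contra hq
  have hgr : -X.gr q = -k - 1 := X.op.d_mem_graded _ _ (dualChain_mem_graded φ hinj) q hq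
  have hgen : X.gen K q ∈ X.graded K (k + 1) := fun r hr => by
    rw [X.eq_of_gen_ne_zero hr]
    linarith
  rw [← X.pairing_gen (X.op.d _), X.pairing_d, pairing_dualChain, hφ _ ⟨_, hgen, rfl⟩] at hq
  exact hq rfl

theorem level_le_neg_level_dualChain (hinj : Set.InjOn X.ω {g : Γ | X.deg g = 0})
    {φ : (X.GradedBase k → X.scalars K) →ₗ[X.scalars K] X.scalars K} {c : X.chains K}
    (hc : c ∈ X.graded K k) (hφ : ∀ y, X.coordsOrder k y ≤
      novikovOrder X.periodGroup K (φ y) + X.coordsOrder k (X.coords k c)) :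
    X.level c ≤ -X.op.level (dualChain φ hinj) := by
  refine iSup_le fun ⟨q, hq⟩ => EReal.le_neg.mpr (iSup_le fun ⟨p, hp⟩ => ?_)
  change ((-X.A p : ℝ) : EReal) ≤ -(X.A q : ℝ)
  rw [← EReal.coe_neg, EReal.coe_le_coe_iff]
  have hgen : ((-X.A p : ℝ) : WithTop ℝ) ≤ X.coordsOrder k (X.coords k (X.gen K p)) :=
    X.coe_le_coordsOrder_coords_iff.mpr fun s x h => by rw [X.eq_of_gen_ne_zero h]
  have hφp : novikovOrder X.periodGroup K (φ (X.coords k (X.gen K p))) ≤ 0 :=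
    novikovOrder_le_of_coeff_ne_zero hp
  have hle : ((-X.A p : ℝ) : WithTop ℝ) ≤ X.coordsOrder k (X.coords k c) :=
    hgen.trans ((hφ _).trans (add_le_of_nonpos_left hφp))
  obtain ⟨t, y, rfl⟩ := exists_point_eq hinj (hc q hq)
  exact X.coe_le_coordsOrder_coords_iff.mp hle t y hq

theorem exists_cycle_exists_dual_cycle (hinj : Set.InjOn X.ω {g : Γ | X.deg g = 0})
    {a : X.homology k} (ha : a ≠ 0) :
    ∃ c : X.cycles k, (X.boundaries k).mkQ c = a ∧ ∃ d : X.op.cycles (-k),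
      X.homologyPairing k ((X.op.boundaries (-k)).mkQ d) a ≠ 0 ∧
        X.level c.1 ≤ -X.op.level d.1 := by
  obtain ⟨c₀, rfl⟩ := (X.boundaries k).mkQ_surjective a
  obtain ⟨y, ⟨x, hx, hxy⟩, φ, hφ, hφc, hle⟩ := exists_dual_eq_one_vanishing_on
    (v := novikovOrder X.periodGroup K) (w := fun s => ((-X.A (X.basePoint s) : ℝ) : WithTop ℝ)) _
    (coords_notMem_boundaryCoords hinj ha)
  let b : X.cycles k := ⟨X.d x, d_mem_cycles hx⟩
  have hb : (X.boundaries k).mkQ b = 0 := (Submodule.Quotient.mk_eq_zero _).mpr ⟨x, hx, rfl⟩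
  obtain rfl : y = X.coords k (b + c₀).1 := by
    rw [Submodule.coe_add, map_add]
    exact sub_eq_iff_eq_add.mp hxy.symm
  refine ⟨b + c₀, by rw [map_add, hb, zero_add], ⟨_, dualChain_mem_cycles hφ⟩, ?_,
    level_le_neg_level_dualChain hinj (b + c₀).2.1 hle⟩
  change X.pairing (dualChain φ hinj) c₀.1 ≠ 0
  rw [pairing_dualChain, hφc]
  exact HahnSeries.coeff_one.trans_ne ((if_pos rfl).trans_ne one_ne_zero)

end Duality

end FloerNovikovComplex

theorem mainTheorem2 {K Γ P S : Type*} [Field K] [AddCommGroup Γ]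
    (X : FloerNovikovComplex K Γ P S)
    (hinj : Set.InjOn X.ω {g : Γ | X.deg g = 0})
    (k : ℤ) (a : X.homology k) (ha : a ≠ 0) :
    X.spectralNumber a ≠ ⊥ ∧ X.spectralNumber a ≠ ⊤ ∧
      X.spectralNumber a =
        -sInf {r : EReal | ∃ b : X.op.homology (-k),
          X.homologyPairing k b a ≠ 0 ∧ r = X.op.spectralNumber b} := by
  obtain ⟨c, rfl, d, hd, hcd⟩ := FloerNovikovComplex.exists_cycle_exists_dual_cycle hinj ha
  have ρ_le := X.spectralNumber_mkQ_le c
  have ρ_op_le := X.op.spectralNumber_mkQ_le d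
  refine ⟨bot_lt_iff_ne_bot.mp ?_, (ρ_le.trans_lt (X.level_lt_top c.1)).ne, le_antisymm ?_ ?_⟩
  · calc ⊥ < -X.op.level d.1 := bot_lt_iff_ne_bot.mpr
          (EReal.neg_eq_bot_iff.not.mpr (X.op.level_lt_top d.1).ne)
      _ ≤ -X.op.spectralNumber ((X.op.boundaries (-k)).mkQ d) := EReal.neg_le_neg_iff.mpr ρ_op_le
      _ ≤ X.spectralNumber ((X.boundaries k).mkQ c) := X.neg_spectralNumber_op_le hd
  · refine ρ_le.trans (hcd.trans (EReal.neg_le_neg_iff.mpr ?_))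
    exact le_trans (sInf_le ⟨_, hd, rfl⟩) ρ_op_le
  · refine EReal.neg_le.mpr (le_sInf ?_)
    rintro _ ⟨b, hb, rfl⟩
    exact EReal.neg_le.mpr (X.neg_spectralNumber_op_le hb)
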